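/- Let $g,d\ge 1$ be integers, let $k_1,\dots,k_g\ge 2$ be integers and put $\mathbf k=(k_1,\dots,k_g)$, $N=\sum_{i=1}^g (k_i-1)$. Write $\mathcal M_n^{sa}$ for the complex self-adjoint $n\times n$ matrices. For an $N$-tuple $A$ of self-adjoint $D\times D$ matrices, the free spectrahedron $\mathcal D_A$ has the levels $$\mathcal D_A(n)=\Big\{X\in(\mathcal M_n^{sa})^{N}:\ \sum_{i=1}^{g}\sum_{j=1}^{k_i-1}A_{i,j}\otimes X_{i,j}\le I_{Dn}\Big\},\qquad n\ge 1,$$ and an inclusion between free spectrahedra means inclusion at every level $n$. The matrix jewel $\mathcal D_{\mathbf k}$ is the free spectrahedron defined by the matrices $$I_{k_1}\otimes\cdots\otimes I_{k_{i-1}}\otimes \mathrm{diag}\big(v^{(k_i)}_j\big)\otimes I_{k_{i+1}}\otimes\cdots\otimes I_{k_g},\qquad i\in\{1,\dots,g\},\ j\in\{1,\dots,k_i-1\},$$ where $v^{(k)}_j\in\mathbb C^{k}$, $v^{(k)}_j(\epsilon)=-\tfrac2k+2\delta_{\epsilon,j}$ for $\epsilon\in\{1,\dots,k\}$. Let $\Delta(g,d,\mathbf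 k)$ be the set of all $s\in\mathbb R^g$ with $s_i\ge 0$ for all $i$ such that for every $B\in(\mathcal M_d^{sa})^{N}$ $$\mathcal D_{\mathbf k}(1)\subseteq\mathcal D_B(1)\ \Longrightarrow\ \{(s_iX_{i,j})_{i,j}: X\in\mathcal D_{\mathbf k}\}\subseteq\mathcal D_B .$$ Let $\Gamma(g,d,\mathbf k)$ be the set of all $s\in[0,1]^g$ such that for all $d$-dimensional POVMs $E^{(i)}=(E^{(i)}_1,\dots,E^{(i)}_{k_i})$, $i=1,\dots,g$ (positive semidefinite $d\times d$ matrices with $\sum_jE^{(i)}_j=I_d$), the noisy POVMs $$\tilde E^{(i)}_j=s_iE^{(i)}_j+(1-s_i)\tfrac1{k_i}I_d$$ are jointly measurable, that is, there is a POVM $(R_{j_1,\dots,j_g})_{j_i\in\{1,\dots,k_i\}}$ of $d\times d$ matrices with $\tilde E^{(u)}_v=\sum_{j:\,j_u=v}R_{j_1,\dots,j_g}$ for all $u\in\{1,\dots,g\}$ and $v\in\{1,\dots,k_u\}$. Then $$\frac1{2d}\Big(\frac1{k_1-1},\dots,\frac1{k_g-1}\Big)\in\Delta(g,d,\mathbf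 k)\qquad\text{and}\qquad \frac1{2d}\Big(\frac1{k_1-1},\dots,\frac1{k_g-1}\Big)\in\Gamma(g,d,\mathbf k).$$ -/

import Mathlib

open scoped Kronecker ComplexOrder

namespace MatrixJewel

noncomputable section

/-- The free spectrahedron `𝒟_A` of a tuple `A` of (self-adjoint) matrices.  Its level `n` is the
set of all tuples `X` of self-adjoint `n × n` matrices with `∑ i, A i ⊗ X i ≤ I`. -/
def freeSpectrahedron {ι κ : Type*} [Fintype ι] [Fintype κ] [DecidableEq κ]
    (A : ι → Matrix κ κ ℂ) (n : ℕ) : Set (ι → Matrix (Fin n) (Fin n) ℂ) :=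
  {X | (∀ i, (X i).IsHermitian) ∧
    ((1 : Matrix (κ × Fin n) (κ × Fin n) ℂ) - ∑ i, A i ⊗ₖ X i).PosSemidef}

/-- The scaled set `s · F = {(s_i X_i)_i : X ∈ F}` for a vector `s` of real numbers. -/
def scaled {ι : Type*} {n : ℕ} (s : ι → ℝ) (F : Set (ι → Matrix (Fin n) (Fin n) ℂ)) :
    Set (ι → Matrix (Fin n) (Fin n) ℂ) :=
  {Y | ∃ X ∈ F, Y = fun i => (s i : ℂ) • X i}

/-- The index set of a family of `g` groups of matrices, the `i`-th one having `k i - 1` members. -/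
abbrev GroupIndex {g : ℕ} (k : Fin g → ℕ) : Type :=
  (i : Fin g) × Fin (k i - 1)

/-- The inclusion set `Δ_{𝒟_A}(g, d, k)`: all nonnegative `s` such that for every tuple `B` of
self-adjoint `d × d` matrices the inclusion `𝒟_A(1) ⊆ 𝒟_B(1)` implies
`(s_1^{×(k_1-1)}, …, s_g^{×(k_g-1)}) · 𝒟_A ⊆ 𝒟_B` (at all levels). -/
def inclusionSet {g : ℕ} (d : ℕ) (k : Fin g → ℕ) {κ : Type*} [Fintype κ] [DecidableEq κ]
    (A : GroupIndex k → Matrix κ κ ℂ) : Set (Fin g → ℝ) :=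
  {s | (∀ i, 0 ≤ s i) ∧
    ∀ B : GroupIndex k → Matrix (Fin d) (Fin d) ℂ, (∀ p, (B p).IsHermitian) →
      freeSpectrahedron A 1 ⊆ freeSpectrahedron B 1 →
        ∀ n : ℕ, scaled (fun p : GroupIndex k => s p.1) (freeSpectrahedron A n)
          ⊆ freeSpectrahedron B n}

/-- The vectors `v_j ∈ ℂ^k`, `v_j(ε) = -2/k + 2 δ_{ε,j}`, for `j = 1, …, k - 1`. -/
def jewelVector (k : ℕ) (j : Fin (k - 1)) (ε : Fin k) : ℂ :=
  -2 / (k : ℂ) + 2 * (if (ε : ℕ) = (j : ℕ) then 1 else 0)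

/-- The tuple defining the matrix jewel: `I^{⊗(i-1)} ⊗ diag(v_j^{(k_i)}) ⊗ I^{⊗(g-i)}`.
The index set of `ℂ^{k_1} ⊗ ⋯ ⊗ ℂ^{k_g}` is the set of all `ε = (ε_1, …, ε_g)` with `ε_i` in the
index set of `ℂ^{k_i}`, so this matrix is diagonal, with `ε`-th diagonal entry
`v_j^{(k_i)}(ε_i)`. -/
def jewelTuple {g : ℕ} (k : Fin g → ℕ) (p : GroupIndex k) :
    Matrix ((i : Fin g) → Fin (k i)) ((i : Fin g) → Fin (k i)) ℂ :=
  Matrix.diagonal fun ε => jewelVector (k p.1) p.2 (ε p.1)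

/-- The inclusion set `Δ(g, d, k)` of the matrix jewel. -/
def jewelInclusionSet {g : ℕ} (d : ℕ) (k : Fin g → ℕ) : Set (Fin g → ℝ) :=
  inclusionSet d k (jewelTuple k)

/-- A `d`-dimensional POVM with outcomes in `α`: positive semidefinite matrices summing to `I`. -/
def IsPOVM {α : Type*} [Fintype α] {d : ℕ} (E : α → Matrix (Fin d) (Fin d) ℂ) : Prop :=
  (∀ a, (E a).PosSemidef) ∧ ∑ a, E a = 1

/-- Joint measurability (compatibility): the `E i` are the marginals of one joint POVM. -/
def JointlyMeasurable {g d : ℕ} {k : Fin g → ℕ}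
    (E : (i : Fin g) → Fin (k i) → Matrix (Fin d) (Fin d) ℂ) : Prop :=
  ∃ R : ((i : Fin g) → Fin (k i)) → Matrix (Fin d) (Fin d) ℂ, IsPOVM R ∧
    ∀ (u : Fin g) (v : Fin (k u)), E u v = ∑ ε with ε u = v, R ε

/-- The balanced compatibility region `Γ(g, d, k)`. -/
def compatibilityRegion {g : ℕ} (d : ℕ) (k : Fin g → ℕ) : Set (Fin g → ℝ) :=
  {s | (∀ i, 0 ≤ s i ∧ s i ≤ 1) ∧
    ∀ E : (i : Fin g) → Fin (k i) → Matrix (Fin d) (Fin d) ℂ, (∀ i, IsPOVM (E i)) →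
      JointlyMeasurable fun i j =>
        (s i : ℂ) • E i j + ((1 - (s i : ℂ)) / (k i : ℂ)) • (1 : Matrix (Fin d) (Fin d) ℂ)}

end

end MatrixJewel

namespace MatrixJewel

open Finset

/-! Compatibility comes from measure-and-prepare. A finite two-design measurement `P` with
normalised vector states `q` satisfies `∑ ω, q ω E • P ω = (E + tr E) / (d + 1)`. Measuring `P` and
giving outcome `j` the weight `(d + 1) s q(E_j) + (1 - s) / k - s tr E_j` therefore produces exactly
the noisy effect `s E_j + (1 - s) / k`. One measurement serves all the POVMs, so they are jointly
measurable once the weights are nonnegative, for which `s (1 + k (d - 1)) ≤ 1` suffices; the stated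
`s` obeys this since `k ≥ 2`.

The jewel statement follows from compatibility. At level one, the inclusion says that `B` encodes
POVMs; a joint POVM `R` of their noisy versions then writes `I - ∑ B ⊗ s X` as a sum of terms `R ε ⊗
(block ε of the jewel inequality at X)`, all positive semidefinite. -/

/-! ### Moments of random phases. -/

/-- The fourth roots of unity. -/
def quarterPhase : Fin 4 → ℂ := ![1, Complex.I, -1, -Complex.I]

theorem quarterPhase_star_mul (m : Fin 4) : star (quarterPhase m) * quarterPhase m = 1 := by
  fin_cases m <;> simp [quarterPhase]

theorem sum_quarterPhase (p q r s : Prop) [Decidable p] [Decidable q] [Decidable r] [Decidable s] :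
    ∑ m, (if p then quarterPhase m else 1) * (if q then star (quarterPhase m) else 1) *
      (if r then star (quarterPhase m) else 1) * (if s then quarterPhase m else 1) =
    if ((p ↔ q) ∧ (r ↔ s)) ∨ ((p ↔ r) ∧ (q ↔ s)) then 4 else 0 := by
  by_cases p <;> by_cases q <;> by_cases r <;> by_cases s <;>
    simp [*, quarterPhase, Fin.sum_univ_four] <;> norm_num

/-- Independent phases factor over coordinates; a factor survives only if its phases cancel. -/
theorem sum_phase_moment {d : ℕ} (a b c e : Fin d) :
    ∑ m : Fin d → Fin 4, quarterPhase (m a) * star (quarterPhase (m b)) *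
      star (quarterPhase (m c)) * quarterPhase (m e) =
    if (a = b ∧ c = e) ∨ (a = c ∧ b = e) then (4 : ℂ) ^ d else 0 := by
  classical
  have h1 : ∀ m : Fin d → Fin 4, quarterPhase (m a) * star (quarterPhase (m b)) *
      star (quarterPhase (m c)) * quarterPhase (m e) =
      ∏ t, (if a = t then quarterPhase (m t) else 1) *
        (if b = t then star (quarterPhase (m t)) else 1) *
        (if c = t then star (quarterPhase (m t)) else 1) *
        (if e = t then quarterPhase (m t) else 1) := by
    intro m
    simp only [Finset.prod_mul_distrib, Finset.prod_ite_eq, mem_univ, if_true]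
  simp_rw [h1]
  rw [← Fintype.prod_sum (fun t m => (if a = t then quarterPhase m else 1) *
        (if b = t then star (quarterPhase m) else 1) *
        (if c = t then star (quarterPhase m) else 1) *
        (if e = t then quarterPhase m else 1))]
  simp_rw [sum_quarterPhase]
  rw [Finset.prod_ite_zero]
  have h2 : (∀ t ∈ (univ : Finset (Fin d)), ((a = t ↔ b = t) ∧ (c = t ↔ e = t)) ∨
      ((a = t ↔ c = t) ∧ (b = t ↔ e = t))) ↔ ((a = b ∧ c = e) ∨ (a = c ∧ b = e)) := by
    constructor
    · intro h
      have ha := h a (mem_univ _)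
      have hb := h b (mem_univ _)
      have hc := h c (mem_univ _)
      have he := h e (mem_univ _)
      grind
    · grind
  simp only [h2]
  simp

/-! ### Vector states and the two-design. -/

/-- The quadratic form `E ↦ ⟨x, E x⟩` of a vector, as a linear functional of the matrix. -/
def vectorState {d : ℕ} (x : Fin d → ℂ) : Matrix (Fin d) (Fin d) ℂ →ₗ[ℂ] ℂ where
  toFun E := star x ⬝ᵥ (E.mulVec x)
  map_add' E F := by rw [Matrix.add_mulVec, dotProduct_add]
  map_smul' c E := by rw [Matrix.smul_mulVec, dotProduct_smul]; rfl

theorem vectorState_apply {d : ℕ} (x : Fin d → ℂ) (E : Matrix (Fin d) (Fin d) ℂ) :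
    vectorState x E = ∑ c, ∑ e, star (x c) * E c e * x e := by
  simp [vectorState, dotProduct, Matrix.mulVec, Finset.mul_sum, mul_assoc]

theorem vectorState_nonneg {d : ℕ} (x : Fin d → ℂ) {E : Matrix (Fin d) (Fin d) ℂ}
    (hE : E.PosSemidef) : 0 ≤ vectorState x E :=
  hE.dotProduct_mulVec_nonneg x

/-- Here `‖x‖² = d` and `E ≤ tr E`. Concretely, sum the values of the form `E` on `x_c δ_c - x_e
δ_e` over all pairs. -/
theorem vectorState_le_card_mul_trace {d : ℕ} {x : Fin d → ℂ} (hx : ∀ c, star (x c) * x c = 1)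
    {E : Matrix (Fin d) (Fin d) ℂ} (hE : E.PosSemidef) :
    vectorState x E ≤ d * E.trace := by
  have hpair : ∀ c e, 0 ≤ E c c + E e e - star (x c) * E c e * x e - star (x e) * E e c * x c := by
    intro c e
    have h := hE.dotProduct_mulVec_nonneg (Pi.single c (x c) - Pi.single e (x e))
    have h3 : star (Pi.single c (x c) - Pi.single e (x e) : Fin d → ℂ) =
        Pi.single c (star (x c)) - Pi.single e (star (x e)) := by
      rw [star_sub, ← Pi.single_star, ← Pi.single_star]
    rw [h3] at h
    simp only [Matrix.mulVec_sub, Matrix.mulVec_single, sub_dotProduct, dotProduct_sub,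
      single_dotProduct] at h
    convert h using 1
    simp only [Pi.smul_apply, Matrix.col_apply, MulOpposite.smul_eq_mul_unop,
      MulOpposite.unop_op]
    linear_combination (-E c c) * hx c - E e e * hx e
  have hsum : 0 ≤ ∑ c, ∑ e,
      (E c c + E e e - star (x c) * E c e * x e - star (x e) * E e c * x c) :=
    Finset.sum_nonneg fun c _ => Finset.sum_nonneg fun e _ => hpair c e
  have heq : ∑ c, ∑ e, (E c c + E e e - star (x c) * E c e * x e - star (x e) * E e c * x c) =
      2 * (d * E.trace - vectorState x E) := by
    simp only [Finset.sum_sub_distrib, Finset.sum_add_distrib]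
    rw [Finset.sum_comm (f := fun c e => star (x e) * E e c * x c), ← vectorState_apply]
    simp [Matrix.trace, ← Finset.mul_sum]
    ring
  rw [heq] at hsum
  rw [← sub_nonneg]
  have h2 : (0 : ℂ) ≤ 1 / 2 := by
    rw [show (1 / 2 : ℂ) = ((1 / 2 : ℝ) : ℂ) by push_cast; rfl]
    exact Complex.zero_le_real.2 (by norm_num)
  have := mul_nonneg h2 hsum
  convert this using 1
  ring

/-- The vector with entries `i ^ (m a)`. -/
def phaseVector {d : ℕ} (m : Fin d → Fin 4) (a : Fin d) : ℂ := quarterPhase (m a)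

/-- Phases alone give `tr E` on the diagonal, missing the summand `E a a` of a two-design; the
standard basis vectors supply it later. -/
theorem sum_vectorState_phaseVector {d : ℕ} (E : Matrix (Fin d) (Fin d) ℂ) (a b : Fin d) :
    ∑ m : Fin d → Fin 4, vectorState (phaseVector m) E * (phaseVector m a * star (phaseVector m b))
      = 4 ^ d * (E a b + (if a = b then E.trace - E a a else 0)) := by
  have h : ∀ m : Fin d → Fin 4,
      vectorState (phaseVector m) E * (phaseVector m a * star (phaseVector m b)) =
      ∑ c, ∑ e, E c e * (quarterPhase (m a) * star (quarterPhase (m b)) *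
      star (quarterPhase (m c)) * quarterPhase (m e)) := by
    intro m
    rw [vectorState_apply]
    simp only [Finset.sum_mul, phaseVector]
    exact Finset.sum_congr rfl fun c _ => Finset.sum_congr rfl fun e _ => by ring
  simp_rw [h]
  rw [Finset.sum_comm]
  have h2 : ∀ c e : Fin d, ∑ m : Fin d → Fin 4, E c e * (quarterPhase (m a) *
      star (quarterPhase (m b)) * star (quarterPhase (m c)) * quarterPhase (m e)) =
      4 ^ d * ((if a = c then if b = e then E c e else 0 else 0) +
        if a = b then (if c = e then E c e else 0) -
          (if a = c then if b = e then E c e else 0 else 0) else 0) := by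
    intro c e
    rw [← Finset.mul_sum, sum_phase_moment]
    by_cases h1 : a = b <;> by_cases h2 : a = c <;> by_cases h3 : b = e <;> by_cases h4 : c = e <;>
      simp [h1, h2, h3, h4, mul_comm] <;> grind
  have h3 : ∀ c : Fin d, ∑ m : Fin d → Fin 4, ∑ e, E c e * (quarterPhase (m a) *
      star (quarterPhase (m b)) * star (quarterPhase (m c)) * quarterPhase (m e)) =
      ∑ e, 4 ^ d * ((if a = c then if b = e then E c e else 0 else 0) +
        if a = b then (if c = e then E c e else 0) -
          (if a = c then if b = e then E c e else 0 else 0) else 0) := by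
    intro c
    rw [Finset.sum_comm]
    exact Finset.sum_congr rfl fun e _ => h2 c e
  simp_rw [h3, ← Finset.mul_sum]
  congr 1
  by_cases hab : a = b
  · subst hab
    simp [Matrix.trace]
  · simp [hab]

/-- A finite measurement reproducing the second moments of the uniform measure on the unit sphere:
`∑ ω, q ω E • P ω = (E + tr E) / (d + 1)`. -/
theorem exists_quantum_two_design {d : ℕ} (hd : 1 ≤ d) :
    ∃ (Ω : Type) (_ : Fintype Ω) (P : Ω → Matrix (Fin d) (Fin d) ℂ)
      (q : Ω → Matrix (Fin d) (Fin d) ℂ →ₗ[ℂ] ℂ),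
      (∀ ω, (P ω).PosSemidef) ∧ (∀ ω, q ω 1 = 1) ∧
      (∀ ω E, E.PosSemidef → 0 ≤ q ω E ∧ q ω E ≤ E.trace) ∧ ∑ ω, P ω = 1 ∧
      ∀ E, ∑ ω, q ω E • P ω = (1 / ((d : ℂ) + 1)) • (E + E.trace • 1) := by
  have hd0 : (d : ℂ) ≠ 0 := by exact_mod_cast (by omega : d ≠ 0)
  have hd1 : (d : ℂ) + 1 ≠ 0 := by exact_mod_cast (by omega : d + 1 ≠ 0)
  have hdi : (0 : ℂ) ≤ (d : ℂ)⁻¹ := by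
    rw [show (d : ℂ)⁻¹ = (((d : ℝ)⁻¹ : ℝ) : ℂ) by push_cast; rfl]
    exact Complex.zero_le_real.2 (by positivity)
  have hx : ∀ (m : Fin d → Fin 4) c, star (phaseVector m c) * phaseVector m c = 1 :=
    fun m c => quarterPhase_star_mul (m c)
  let P : (Fin d → Fin 4) ⊕ Fin d → Matrix (Fin d) (Fin d) ℂ := Sum.elim
    -- The factor `d` offsets the normalisation `1 / d` of the phase states in `q`.
    (fun m => (((d / ((d + 1) * 4 ^ d) : ℝ)) : ℂ) •
      Matrix.vecMulVec (phaseVector m) (star (phaseVector m)))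
    (fun f => (((1 / (d + 1) : ℝ)) : ℂ) •
      Matrix.vecMulVec (Pi.single f 1) (star (Pi.single f 1)))
  let q : (Fin d → Fin 4) ⊕ Fin d → Matrix (Fin d) (Fin d) ℂ →ₗ[ℂ] ℂ := Sum.elim
    (fun m => (d : ℂ)⁻¹ • vectorState (phaseVector m)) (fun f => vectorState (Pi.single f 1))
  have hqr : ∀ f E, q (Sum.inr f) E = E f f := by
    intro f E
    simp [q, vectorState]
  have hq1 : ∀ ω, q ω 1 = 1 := by
    rintro (m | f)
    · have : vectorState (phaseVector m) 1 = d := by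
        simp only [vectorState, LinearMap.coe_mk, AddHom.coe_mk, Matrix.one_mulVec, dotProduct,
          Pi.star_apply, hx]
        simp
      simp [q, this, hd0]
    · simp [hqr]
  have hdesign : ∀ E, ∑ ω, q ω E • P ω = (1 / ((d : ℂ) + 1)) • (E + E.trace • 1) := by
    intro E
    ext a b
    have hl : ∀ m, (q (Sum.inl m) E • P (Sum.inl m)) a b = (1 / ((d + 1) * 4 ^ d) : ℂ) *
        (vectorState (phaseVector m) E * (phaseVector m a * star (phaseVector m b))) := by
      intro m
      simp [q, P, Matrix.vecMulVec_apply]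
      field_simp
    have hr : ∀ f, (q (Sum.inr f) E • P (Sum.inr f)) a b =
        (1 / (d + 1) : ℂ) * (if f = a then if a = b then E a a else 0 else 0) := by
      intro f
      rw [Matrix.smul_apply, hqr]
      by_cases h1 : f = a
      · subst h1
        by_cases h2 : f = b
        · subst h2
          simp [P, Matrix.vecMulVec_apply, mul_comm]
        · simp [P, Matrix.vecMulVec_apply, h2, Ne.symm h2]
      · simp [P, Matrix.vecMulVec_apply, h1, Pi.single_apply, Ne.symm h1]
    rw [Matrix.sum_apply, Fintype.sum_sum_type]
    simp_rw [hl, hr]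
    rw [← Finset.mul_sum, ← Finset.mul_sum, sum_vectorState_phaseVector]
    by_cases hab : a = b
    · subst hab
      simp
      field_simp
      ring
    · simp [hab]
      field_simp
  refine ⟨_, inferInstance, P, q, ?_, hq1, ?_, ?_, hdesign⟩
  · rintro (m | f)
    · exact (Matrix.posSemidef_vecMulVec_self_star _).smul
        (Complex.zero_le_real.2 (by positivity))
    · exact (Matrix.posSemidef_vecMulVec_self_star _).smul
        (Complex.zero_le_real.2 (by positivity))
  · rintro (m | f) E hE
    · refine ⟨mul_nonneg hdi (vectorState_nonneg _ hE), ?_⟩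
      have := mul_le_mul_of_nonneg_left (vectorState_le_card_mul_trace (hx m) hE) hdi
      rwa [inv_mul_cancel_left₀ hd0] at this
    · rw [hqr]
      exact ⟨hE.diag_nonneg, Finset.single_le_sum (f := fun i => E i i)
        (fun i _ => hE.diag_nonneg) (mem_univ f)⟩
  · have h := hdesign 1
    simp only [hq1, one_smul] at h
    rw [h]
    have : (1 : Matrix (Fin d) (Fin d) ℂ) + (1 : Matrix (Fin d) (Fin d) ℂ).trace • 1 =
        ((d : ℂ) + 1) • 1 := by
      rw [Matrix.trace_one, Fintype.card_fin, add_smul, one_smul, add_comm]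
    rw [this, smul_smul, one_div_mul_cancel hd1, one_smul]

/-! ### Joint measurability by post-processing. -/

theorem sum_prod_filter_apply_eq {g : ℕ} {k : Fin g → ℕ} {p : (i : Fin g) → Fin (k i) → ℂ}
    (hp : ∀ i, ∑ j, p i j = 1) (u : Fin g) (v : Fin (k u)) :
    ∑ ε : (i : Fin g) → Fin (k i) with ε u = v, ∏ i, p i (ε i) = p u v := by
  have h : ({ε : (i : Fin g) → Fin (k i) | ε u = v} : Finset _) =
      Fintype.piFinset (Function.update (fun i => (univ : Finset (Fin (k i)))) u {v}) := by
    ext ε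
    simp only [mem_filter, mem_univ, true_and, Fintype.mem_piFinset]
    constructor
    · rintro rfl i
      by_cases hi : i = u
      · subst hi; simp
      · simp [hi]
    · intro h
      simpa using h u
  rw [h, ← Finset.prod_univ_sum, Finset.prod_eq_single u]
  · simp
  · intro i _ hi
    simp [hi, hp]
  · simp

/-- Post-processing a single measurement `P` by conditional probabilities gives jointly measurable
measurements. -/
theorem jointlyMeasurable_of_postprocessing {g d : ℕ} {k : Fin g → ℕ} {Ω : Type} [Fintype Ω]
    {P : Ω → Matrix (Fin d) (Fin d) ℂ} (hP : ∀ ω, (P ω).PosSemidef) (hP1 : ∑ ω, P ω = 1)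
    {p : Ω → (i : Fin g) → Fin (k i) → ℂ} (hp : ∀ ω i j, 0 ≤ p ω i j)
    (hp1 : ∀ ω i, ∑ j, p ω i j = 1)
    {E : (i : Fin g) → Fin (k i) → Matrix (Fin d) (Fin d) ℂ}
    (hE : ∀ i j, E i j = ∑ ω, p ω i j • P ω) : JointlyMeasurable E := by
  -- Given `ω`, the `g` outcomes are drawn independently.
  refine ⟨fun ε => ∑ ω, (∏ i, p ω i (ε i)) • P ω, ⟨fun ε => ?_, ?_⟩, fun u v => ?_⟩
  · exact Matrix.posSemidef_sum _ fun ω _ =>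
      (hP ω).smul (Finset.prod_nonneg fun i _ => hp ω i _)
  · rw [Finset.sum_comm]
    simp_rw [← Finset.sum_smul]
    rw [← hP1]
    refine Finset.sum_congr rfl fun ω _ => ?_
    rw [← Fintype.prod_sum]
    simp [hp1]
  · rw [Finset.sum_comm, hE]
    simp_rw [← Finset.sum_smul]
    exact Finset.sum_congr rfl fun ω _ => by rw [sum_prod_filter_apply_eq (hp1 ω)]

theorem IsPOVM.one_sub_posSemidef {α : Type*} [Fintype α] {d : ℕ}
    {E : α → Matrix (Fin d) (Fin d) ℂ} (hE : IsPOVM E) (a : α) : (1 - E a).PosSemidef := by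
  classical
  rw [← hE.2, ← Finset.add_sum_erase _ _ (mem_univ a), add_sub_cancel_left]
  exact Matrix.posSemidef_sum _ fun b _ => hE.1 b

theorem mem_compatibilityRegion_of_le {g d : ℕ} (hd : 1 ≤ d) {k : Fin g → ℕ} (hk : ∀ i, 1 ≤ k i)
    {s : Fin g → ℝ} (hs0 : ∀ i, 0 ≤ s i) (hs : ∀ i, s i * (1 + k i * (d - 1)) ≤ 1) :
    s ∈ compatibilityRegion d k := by
  have hd' : (1 : ℝ) ≤ d := by exact_mod_cast hd
  have hk' : ∀ i, (1 : ℝ) ≤ k i := fun i => by exact_mod_cast hk i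
  have hd1 : (d : ℂ) + 1 ≠ 0 := by exact_mod_cast (by omega : d + 1 ≠ 0)
  refine ⟨fun i => ⟨hs0 i, ?_⟩, fun E hE => ?_⟩
  · have := mul_nonneg (hs0 i) (mul_nonneg (zero_le_one.trans (hk' i)) (sub_nonneg.2 hd'))
    linarith [hs i]
  obtain ⟨Ω, _, P, q, hP, hq1, hq, hP1, hdesign⟩ := exists_quantum_two_design hd
  refine jointlyMeasurable_of_postprocessing hP hP1
    (p := fun ω i j => (d + 1) * s i * q ω (E i j) + ((1 - s i) / k i - s i * (E i j).trace))
    (fun ω i j => ?_) (fun ω i => ?_) (fun i j => ?_)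
  · have h1 := (hq ω _ ((hE i).1 j)).1
    have h2 := sub_nonneg.2 (hq ω _ ((hE i).one_sub_posSemidef j)).2
    have h3 : (0 : ℂ) ≤ ((d * s i : ℝ) : ℂ) :=
      Complex.zero_le_real.2 (mul_nonneg (by linarith) (hs0 i))
    have h4 : (0 : ℂ) ≤ (s i : ℂ) := Complex.zero_le_real.2 (hs0 i)
    have h5 : (0 : ℂ) ≤ (((1 - s i) / k i - s i * (d - 1) : ℝ) : ℂ) := by
      refine Complex.zero_le_real.2 (sub_nonneg.2 ?_)
      rw [le_div_iff₀ (by linarith [hk' i])]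
      linarith [hs i]
    -- The weight equals `d s q(E) + s (tr (1 - E) - q(1 - E)) + ((1 - s) / k - s (d - 1))`.
    have h := add_nonneg (add_nonneg (mul_nonneg h3 h1) (mul_nonneg h4 h2)) h5
    convert h using 1
    simp only [map_sub, hq1, Matrix.trace_sub, Matrix.trace_one, Fintype.card_fin]
    push_cast
    ring
  · have hk0 : (k i : ℂ) ≠ 0 := by exact_mod_cast (by have := hk i; omega : k i ≠ 0)
    rw [Finset.sum_add_distrib, Finset.sum_sub_distrib, ← Finset.mul_sum, ← Finset.mul_sum,
      ← map_sum, ← Matrix.trace_sum, (hE i).2, hq1]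
    simp [mul_div_cancel₀ _ hk0]
    ring
  · rw [← sub_eq_zero]
    simp_rw [add_smul]
    rw [Finset.sum_add_distrib, ← Finset.smul_sum, hP1]
    simp_rw [mul_smul _ _ (P _)]
    rw [← Finset.smul_sum, hdesign, smul_smul, mul_one_div, mul_div_cancel_left₀ _ hd1]
    module

/-! ### POVMs from the level-one inclusion. -/

theorem sum_dite_lt_pred {M : Type*} [AddCommMonoid M] {k : ℕ} (hk : 1 ≤ k) (f : Fin (k - 1) → M)
    (c : M) : ∑ m : Fin k, (if h : (m : ℕ) < k - 1 then f ⟨m, h⟩ else c) = ∑ j, f j + c := by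
  obtain ⟨n, rfl⟩ := Nat.exists_eq_add_of_le' hk
  rw [Fin.sum_univ_castSucc]
  simp

theorem sum_single_block {g : ℕ} {k : Fin g → ℕ} {M : Type*} [AddCommMonoid M] [Module ℂ M]
    (i : Fin g) (y : Fin (k i - 1) → ℝ) (F : GroupIndex k → M) :
    ∑ p : GroupIndex k,
      ((Pi.single (M := fun i => Fin (k i - 1) → ℝ) i y p.1 p.2 : ℝ) : ℂ) • F p =
    ∑ j, (y j : ℂ) • F ⟨i, j⟩ := by
  rw [Fintype.sum_sigma, Finset.sum_eq_single i]
  · simp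
  · intro i' _ hi
    simp [hi]
  · simp

/-- The first level of an inclusion of the matrix jewel, tested on a point of a single block. -/
theorem posSemidef_of_level_one_inclusion {g d : ℕ} {k : Fin g → ℕ}
    {B : GroupIndex k → Matrix (Fin d) (Fin d) ℂ}
    (hB : freeSpectrahedron (jewelTuple k) 1 ⊆ freeSpectrahedron B 1) (i : Fin g)
    (y : Fin (k i - 1) → ℝ)
    (hy : ∀ ε : Fin (k i), 0 ≤ 1 - ∑ j, (y j : ℂ) * jewelVector (k i) j ε) :
    (1 - ∑ j, (y j : ℂ) • B ⟨i, j⟩).PosSemidef := by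
  let x : GroupIndex k → ℝ := fun p => Pi.single (M := fun i => Fin (k i - 1) → ℝ) i y p.1 p.2
  have hX : (fun p => (x p : ℂ) • (1 : Matrix (Fin 1) (Fin 1) ℂ)) ∈
      freeSpectrahedron (jewelTuple k) 1 := by
    refine ⟨fun p => ?_, ?_⟩
    · simp [Matrix.IsHermitian, Matrix.conjTranspose_smul]
    · have h : (1 : Matrix (((i : Fin g) → Fin (k i)) × Fin 1) (((i : Fin g) → Fin (k i)) × Fin 1) ℂ)
          - ∑ p, jewelTuple k p ⊗ₖ ((x p : ℂ) • (1 : Matrix (Fin 1) (Fin 1) ℂ)) =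
          Matrix.diagonal fun a => 1 - ∑ j, (y j : ℂ) * jewelVector (k i) j (a.1 i) := by
        have h1 : ∀ p, jewelTuple k p ⊗ₖ ((x p : ℂ) • (1 : Matrix (Fin 1) (Fin 1) ℂ)) =
            (x p : ℂ) • Matrix.diagonal fun a => jewelVector (k p.1) p.2 (a.1 p.1) := by
          intro p
          rw [Matrix.kronecker_smul, jewelTuple, ← Matrix.diagonal_one,
            Matrix.diagonal_kronecker_diagonal]
          simp
        simp_rw [h1]
        rw [sum_single_block]
        ext a b
        rw [Matrix.sub_apply, Matrix.sum_apply]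
        by_cases hab : a = b
        · subst hab; simp
        · simp [hab]
      rw [h]
      exact Matrix.PosSemidef.diagonal fun a => hy (a.1 i)
  have h := (hB hX).2.submatrix (fun a : Fin d => (a, (0 : Fin 1)))
  rw [← sum_single_block]
  convert h using 1
  ext a b
  simp [Matrix.sum_apply, Matrix.one_apply, x, mul_comm]

/-- The matrices `E_1, …, E_k` with `B_j = 2 E_j - (2 / k) I` for `j < k` and `∑ j, E_j = I`. -/
noncomputable def effectOfTuple {g d : ℕ} {k : Fin g → ℕ} (B : GroupIndex k → Matrix (Fin d) (Fin d) ℂ)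
    (i : Fin g) (m : Fin (k i)) : Matrix (Fin d) (Fin d) ℂ :=
  if h : (m : ℕ) < k i - 1 then (1 / 2 : ℂ) • B ⟨i, ⟨m, h⟩⟩ + (1 / (k i : ℂ)) • 1
  else 1 - ∑ j, ((1 / 2 : ℂ) • B ⟨i, j⟩ + (1 / (k i : ℂ)) • 1)

/-- In one block, level one of the jewel is a simplex with `k` vertices; testing the inclusion at
each vertex gives `k E_m ≥ 0`. -/
theorem isPOVM_effectOfTuple {g d : ℕ} {k : Fin g → ℕ} (hk : ∀ i, 1 ≤ k i)
    {B : GroupIndex k → Matrix (Fin d) (Fin d) ℂ}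
    (hB : freeSpectrahedron (jewelTuple k) 1 ⊆ freeSpectrahedron B 1) (i : Fin g) :
    IsPOVM (effectOfTuple B i) := by
  have hk0 : (k i : ℂ) ≠ 0 := by exact_mod_cast (by have := hk i; omega : k i ≠ 0)
  have hki : (0 : ℂ) ≤ ((1 / k i : ℝ) : ℂ) := Complex.zero_le_real.2 (by positivity)
  have hkn : (0 : ℂ) ≤ ((k i : ℝ) : ℂ) := Complex.zero_le_real.2 (by positivity)
  have hcast : ((k i - 1 : ℕ) : ℂ) = k i - 1 := by
    rw [Nat.cast_sub (hk i), Nat.cast_one]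
  refine ⟨fun m => ?_, ?_⟩
  · by_cases hm : (m : ℕ) < k i - 1
    -- At this vertex the jewel slack is `k` for `ε = m` and `0` otherwise.
    · have h := posSemidef_of_level_one_inclusion hB i
        (Pi.single ⟨m, hm⟩ (-(k i : ℝ) / 2)) (fun ε => ?_)
      · convert h.smul hki using 1
        rw [Finset.sum_eq_single (⟨m, hm⟩ : Fin (k i - 1))
          (fun j _ hj => by simp [hj]) (by simp), effectOfTuple, dif_pos hm]
        simp only [Pi.single_eq_same]
        push_cast
        rw [smul_sub, smul_smul, show (1 / (k i : ℂ)) * (-(k i : ℂ) / 2) = -(1 / 2) by field_simp]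
        module
      · rw [Finset.sum_eq_single (⟨m, hm⟩ : Fin (k i - 1))
          (fun j _ hj => by simp [hj]) (by simp)]
        simp only [Pi.single_eq_same, jewelVector]
        push_cast
        split_ifs
        · convert hkn using 1
          push_cast
          field_simp
          ring
        · apply le_of_eq
          field_simp
          ring
    -- The remaining vertex, with slack only at the last `ε`, tests the complementary effect.
    · have h := posSemidef_of_level_one_inclusion hB i (fun _ => (k i : ℝ) / 2) (fun ε => ?_)
      · convert h.smul hki using 1
        rw [effectOfTuple, dif_neg hm, Finset.sum_add_distrib, ← Finset.smul_sum,
          ← Finset.smul_sum, Finset.sum_const, Finset.card_univ, Fintype.card_fin,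
          ← Nat.cast_smul_eq_nsmul ℂ, hcast]
        push_cast
        rw [smul_sub, ← Finset.smul_sum, smul_smul, smul_smul,
          show (1 / (k i : ℂ)) * ((k i : ℂ) / 2) = 1 / 2 by field_simp,
          show (1 / (k i : ℂ)) * ((k i : ℂ) - 1) = 1 - 1 / k i by field_simp]
        module
      · have hsum : ∑ j : Fin (k i - 1), (if (ε : ℕ) = (j : ℕ) then (1 : ℂ) else 0) =
            if (ε : ℕ) < k i - 1 then 1 else 0 := by
          by_cases hε : (ε : ℕ) < k i - 1
          · rw [Finset.sum_eq_single (⟨ε, hε⟩ : Fin (k i - 1))]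
            · simp [hε]
            · intro j _ hj
              rw [if_neg]
              rintro h
              exact hj (Fin.ext h.symm)
            · simp
          · rw [if_neg hε]
            refine Finset.sum_eq_zero fun j _ => if_neg ?_
            have := j.2
            omega
        rw [← Finset.mul_sum]
        simp only [jewelVector]
        rw [Finset.sum_add_distrib, ← Finset.mul_sum, hsum, Finset.sum_const, Finset.card_univ,
          Fintype.card_fin, nsmul_eq_mul, hcast]
        split_ifs
        · apply le_of_eq
          push_cast
          field_simp
          ring
        · convert hkn using 1
          push_cast
          field_simp
          ring
  · unfold effectOfTuple
    rw [sum_dite_lt_pred (hk i) (fun j => (1 / 2 : ℂ) • B ⟨i, j⟩ + (1 / (k i : ℂ)) • 1)]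
    abel

/-! ### From compatibility to inclusion, and the constant. -/

theorem mem_jewelInclusionSet_of_mem_compatibilityRegion {g d : ℕ} {k : Fin g → ℕ}
    (hk : ∀ i, 1 ≤ k i) {s : Fin g → ℝ} (hs : s ∈ compatibilityRegion d k) :
    s ∈ jewelInclusionSet d k := by
  refine ⟨fun i => (hs.1 i).1, fun B _ hB n => ?_⟩
  rintro _ ⟨X, hX, rfl⟩
  obtain ⟨R, hR, hRE⟩ := hs.2 (effectOfTuple B) (isPOVM_effectOfTuple hk hB)
  refine ⟨fun p => ?_, ?_⟩
  · rw [Matrix.IsHermitian, Matrix.conjTranspose_smul, (hX.1 p).eq]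
    simp
  have hblock : ∀ ε : (i : Fin g) → Fin (k i),
      (1 - ∑ p : GroupIndex k, jewelVector (k p.1) p.2 (ε p.1) • X p).PosSemidef := by
    intro ε
    convert hX.2.submatrix (fun a : Fin n => (ε, a)) using 1
    ext a b
    simp [Matrix.sum_apply, Matrix.one_apply, jewelTuple]
  -- The offset `-2 / k` in the jewel vectors cancels the uniform noise.
  have hmarg : ∀ p : GroupIndex k, ∑ ε, jewelVector (k p.1) p.2 (ε p.1) • R ε =
      (s p.1 : ℂ) • B p := by
    rintro ⟨i, j⟩
    have hj : (j : ℕ) < k i := by omega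
    have hk0 : (k i : ℂ) ≠ 0 := by exact_mod_cast (by have := hk i; omega : k i ≠ 0)
    have h := hRE i ⟨j, hj⟩
    rw [Finset.sum_filter] at h
    have h2 : ∀ ε : (i : Fin g) → Fin (k i), jewelVector (k i) j (ε i) • R ε =
        (-2 / (k i : ℂ)) • R ε + (2 : ℂ) • (if ε i = ⟨j, hj⟩ then R ε else 0) := by
      intro ε
      simp only [jewelVector, Fin.ext_iff]
      split_ifs <;> module
    simp_rw [h2]
    rw [Finset.sum_add_distrib, ← Finset.smul_sum, ← Finset.smul_sum, hR.2, ← h]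
    have hE : effectOfTuple B i ⟨j, hj⟩ = (1 / 2 : ℂ) • B ⟨i, j⟩ + (1 / (k i : ℂ)) • 1 :=
      dif_pos j.2
    simp only [hE]
    module
  have hsum : (1 : Matrix (Fin d × Fin n) (Fin d × Fin n) ℂ) -
      ∑ p : GroupIndex k, B p ⊗ₖ ((s p.1 : ℂ) • X p) =
      ∑ ε, R ε ⊗ₖ (1 - ∑ p : GroupIndex k, jewelVector (k p.1) p.2 (ε p.1) • X p) := by
    ext ⟨a, a'⟩ ⟨b, b'⟩
    have h1 : ∑ ε, R ε a b = (1 : Matrix (Fin d) (Fin d) ℂ) a b := by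
      rw [← hR.2, Matrix.sum_apply]
    have h2 : ∀ p : GroupIndex k, ∑ ε, jewelVector (k p.1) p.2 (ε p.1) * R ε a b =
        s p.1 * B p a b := by
      intro p
      have := congrFun (congrFun (hmarg p) a) b
      simpa [Matrix.sum_apply] using this
    simp only [Matrix.sub_apply, Matrix.sum_apply, Matrix.kroneckerMap_apply, Matrix.smul_apply,
      smul_eq_mul, mul_sub, Finset.sum_sub_distrib, ← Finset.sum_mul, h1, Finset.mul_sum]
    rw [Finset.sum_comm]
    congr 1
    · rw [← Matrix.one_kronecker_one, Matrix.kroneckerMap_apply]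
    · refine Finset.sum_congr rfl fun p _ => ?_
      rw [show B p a b * (s p.1 * X p a' b') = s p.1 * B p a b * X p a' b' by ring, ← h2,
        Finset.sum_mul]
      exact Finset.sum_congr rfl fun ε _ => by ring
  rw [hsum]
  exact Matrix.posSemidef_sum _ fun ε _ => (hR.1 ε).kronecker (hblock ε)

end MatrixJewel

theorem mainTheorem3 (g d : ℕ) (hg : 1 ≤ g) (hd : 1 ≤ d) (k : Fin g → ℕ) (hk : ∀ i, 2 ≤ k i) :
    (fun i => 1 / (2 * (d : ℝ)) * (1 / ((k i : ℝ) - 1))) ∈ MatrixJewel.jewelInclusionSet d k ∧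
    (fun i => 1 / (2 * (d : ℝ)) * (1 / ((k i : ℝ) - 1))) ∈
      MatrixJewel.compatibilityRegion d k := by
  have hk1 : ∀ i, 1 ≤ k i := fun i => (hk i).trans' one_le_two
  have hd' : (1 : ℝ) ≤ d := by exact_mod_cast hd
  have hk' : ∀ i, (2 : ℝ) ≤ k i := fun i => by exact_mod_cast hk i
  suffices h : (fun i => 1 / (2 * (d : ℝ)) * (1 / ((k i : ℝ) - 1))) ∈
      MatrixJewel.compatibilityRegion d k from
    ⟨MatrixJewel.mem_jewelInclusionSet_of_mem_compatibilityRegion hk1 h, h⟩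
  refine MatrixJewel.mem_compatibilityRegion_of_le hd hk1 (fun i => ?_) (fun i => ?_)
  · have : (0 : ℝ) ≤ k i - 1 := by linarith [hk' i]
    positivity
  · have h1 : (0 : ℝ) < 2 * d * (k i - 1) := mul_pos (by linarith) (by linarith [hk' i])
    rw [one_div_mul_one_div, one_div_mul_eq_div, div_le_one h1]
    -- `2 d (k - 1) - (1 + k (d - 1)) = d (k - 2) + (k - 1)`.
    nlinarith [mul_nonneg (zero_le_one.trans hd') (sub_nonneg.2 (hk' i)), hk' i]
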